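/- Let $p$ be a prime, let $K$ be an algebraically closed field of characteristic $p$ and let $G$ be a subgroup of $(K,+)$ (for instance, let $(K,G)$ be a monster model of $\mathrm{ACFG}$, the model companion of the theory of algebraically closed fields of characteristic $p$ with a predicate for an additive subgroup). For $X\subseteq K$ let $\overline{X}$ be the set of elements of $K$ that are algebraic over the subfield generated by $X$, and let $G(X)=G\cap X$; $X$ is called algebraically closed if $\overline X=X$. For subsets $A,B,C$ of $K$, juxtaposition denoting union, define the following. - $A\perp^{\mathrm{ACF}}_C B$ (forking independence in $\mathrm{ACF}$, that is, algebraic independence): every subset of $A$ that is algebraically independent over the field generated by $C$ is algebraically independent over the field generated by $BC$. - Weak independence, $A\perp^{w}_C B$: $A\perp^{\mathrm{ACF}}_C B$ and $G(\overline{AC}+\overline{BC})=G(\overline{AC})+G(\overline{BC})$. - Strong independence, $A\perp^{st}_C B$: $A\perp^{\mathrm{ACF}}_C B$ and $G(\overline{ABC})=G(\overline{AC})+G(\overline{BC})$. - The monotonised weak independence, $A\,(\perp^{w})^{m}_C\,B$: $A\perp^{w}_{CD} BC$ for all $D\subseteq CB$. Mixed transitivity on the left: let $A,B,C,D\subseteq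 K$ be algebraically closed with $C\subseteq A\cap B$ and $B\subseteq D$. If $A\,(\perp^{w})^{m}_C\,B$ and $A\perp^{st}_B D$, then $A\,(\perp^{w})^{m}_C\,D$. -/

import Mathlib

open scoped Pointwise

namespace ACFG

section Monotonised

variable {M : Type*}

/-- The monotonised `ind^m` of a ternary relation on subsets of `M`. We write `ind A C B` for
"`A` is independent from `B` over the base `C`". By definition `ind^m A C B` holds when
`A` is independent from `B ∪ C` over `C ∪ D` for every `D ⊆ C ∪ B`. -/
def Monotonised (ind : Set M → Set M → Set M → Prop) (A C B : Set M) : Prop :=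
  ∀ D : Set M, D ⊆ C ∪ B → ind A (C ∪ D) (B ∪ C)

end Monotonised

section Independence

variable {K : Type*} [Field K]

/-- The algebraic closure of a set `X` in the field `K`: all the elements of `K` that are algebraic
over the subfield generated by `X`. -/
def acl (X : Set K) : Set K :=
  {x : K | IsAlgebraic (Subfield.closure X) x}

/-- `X` is an algebraically closed set. -/
def IsAclClosed (X : Set K) : Prop := acl X = X

/-- Independence in the sense of algebraically closed fields (non-forking in `ACF`):
`A` is independent from `B` over `C` if every subset of `A` that is algebraically independent over
the field generated by `C` remains so over the field generated by `B ∪ C`. -/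
def AcfIndep (A C B : Set K) : Prop :=
  ∀ s : Set K, s ⊆ A →
    AlgebraicIndepOn (Subfield.closure C) id s →
      AlgebraicIndepOn (Subfield.closure (B ∪ C)) id s

/-- Weak independence in `(K, G)`: `A` and `B` are independent over `C` in the sense of
algebraically closed fields, and
`G ∩ (acl (AC) + acl (BC)) = G ∩ acl (AC) + G ∩ acl (BC)`. -/
def WeakIndep (G : AddSubgroup K) (A C B : Set K) : Prop :=
  AcfIndep A C B ∧
    (G : Set K) ∩ (acl (A ∪ C) + acl (B ∪ C)) =
      ((G : Set K) ∩ acl (A ∪ C)) + ((G : Set K) ∩ acl (B ∪ C))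

/-- Strong independence in `(K, G)`: `A` and `B` are independent over `C` in the sense of
algebraically closed fields, and `G ∩ acl (ABC) = G ∩ acl (AC) + G ∩ acl (BC)`. -/
def StrongIndep (G : AddSubgroup K) (A C B : Set K) : Prop :=
  AcfIndep A C B ∧
    (G : Set K) ∩ acl (A ∪ B ∪ C) =
      ((G : Set K) ∩ acl (A ∪ C)) + ((G : Set K) ∩ acl (B ∪ C))

end Independence

end ACFG

/-!
Write `E` for the algebraic closure of `C ∪ X`, where `X ⊆ D` is the extra base. The hypotheses make
every subset of `A` that is algebraically independent over `C` independent over `D` (transitivity),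
so fix a transcendence basis `s` of `A` over `C`. Only the statement about `G` requires work.

Let `g = x + d ∈ G` with `x` algebraic over `A ∪ E` and `d ∈ D`. Strong independence gives
`g = u + v` with `u ∈ G` algebraic over `A ∪ B` and `v ∈ G ∩ D`. If `u` lies in
`acl (A ∪ (B ∩ E)) + B`, then the hypothesis on `A` and `B` over the base `C ∪ (B ∩ E)` splits `u`
as required, and hence `g`. Two facts give this, both of them independent of `G`:

* `ACFG.exists_sub_eq_of_mem_acl`: as `u - x ∈ D`, there are `b ∈ B` and `e ∈ E` with
  `u - x = b - e`;
* `ACFG.mem_acl_inter`: `w = u - b = x - e`, being algebraic both over `B ∪ s` and over `E ∪ s`, is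
  algebraic over `(B ∩ E) ∪ s`.

Both are proved by specialising `s` to elements of `C`, which is the model-theoretic fact that the
type of `A` over `D` is finitely satisfiable in `C`. A specialisation is a place of `K`, given by a
valuation ring `V` containing `D`, at which each element of `s` is congruent to an element of `C`.
Such places exist because `D[s]` is a polynomial ring, and since `C` is infinite the point in `C`
can avoid the zero locus of any given nonzero polynomial (`ACFG.genericPlaces_neBot`). At a generic
such place, an element algebraic over `B ∪ s` is finite with residue in `B`
(`ACFG.eventually_mem_residueSubring`); the same holds for `E`. For the first fact, reduce the
equation modulo the maximal ideal. For the second, if `w` is algebraic over `(B ∩ E) ∪ s ∪ Y ∪ {β}`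
but not without `β`, exchange makes `β` algebraic over `(B ∩ E) ∪ s ∪ Y ∪ {w}`; the residue of `w`
lies in `B ∩ E`, so reducing this relation shows that `β` is algebraic over `(B ∩ E) ∪ Y`
(`ACFG.mem_of_mem_acl_insert`), which is absurd.
-/

open Filter

namespace ACFG

/-! ### Algebraic closure as a closure operator -/

section Acl

variable {K : Type*} [Field K]

theorem isAlgebraic_subring_iff_subfield {S : Subring K} {F : Subfield K} (hSF : S ≤ F.toSubring)
    (hF : ∀ z ∈ F, ∃ y ∈ S, ∃ t ∈ S, y / t = z) {x : K} :
    IsAlgebraic S x ↔ IsAlgebraic F x := by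
  let : Algebra S F := (Subring.inclusion hSF : S →+* F.toSubring).toAlgebra
  have : IsScalarTower S F K := .of_algebraMap_eq fun _ ↦ rfl
  have : FaithfulSMul S F :=
    (faithfulSMul_iff_algebraMap_injective _ _).2 (Subring.inclusion_injective hSF)
  have : IsFractionRing S F := IsFractionRing.of_field _ _ fun z ↦ by
    obtain ⟨y, hy, t, ht, h⟩ := hF z z.2
    exact ⟨⟨y, hy⟩, ⟨t, ht⟩, Subtype.ext h.symm⟩
  exact IsFractionRing.isAlgebraic_iff S F K

theorem mem_acl_iff_isAlgebraic_subring {X : Set K} {x : K} :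
    x ∈ acl X ↔ IsAlgebraic (Subring.closure X) x :=
  (isAlgebraic_subring_iff_subfield (Subfield.subring_closure_le X)
    fun _ ↦ Subfield.mem_closure_iff.1).symm

theorem mem_acl_of_isAlgebraic {R : Type*} [CommRing R] [Algebra R K] {X : Set K} {x : K}
    (hR : ∀ r : R, algebraMap R K r ∈ Subfield.closure X)
    (hinj : Function.Injective (algebraMap R K)) (hx : IsAlgebraic R x) : x ∈ acl X := by
  let φ : R →+* Subfield.closure X := (algebraMap R K).codRestrict _ hR
  let : Algebra R (Subfield.closure X) := φ.toAlgebra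
  have : IsScalarTower R (Subfield.closure X) K := .of_algebraMap_eq fun _ ↦ rfl
  exact hx.extendScalars (R := R) (S := Subfield.closure X)
    fun a b h ↦ hinj (congrArg Subtype.val h)

theorem mem_acl_of_isAlgebraic_adjoin {F : Subfield K} {s X : Set K} {x : K}
    (hF : F ≤ Subfield.closure X) (hs : s ⊆ X) (hx : IsAlgebraic (Algebra.adjoin F s) x) :
    x ∈ acl X := by
  refine mem_acl_of_isAlgebraic (R := Algebra.adjoin F s) (fun r ↦ ?_) Subtype.val_injective hx
  obtain ⟨r, hr⟩ := r
  change r ∈ Subfield.closure X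
  induction hr using Algebra.adjoin_induction with
  | mem y hy => exact Subfield.subset_closure (hs hy)
  | algebraMap y => exact hF y.2
  | add _ _ _ _ h₁ h₂ => exact add_mem h₁ h₂
  | mul _ _ _ _ h₁ h₂ => exact mul_mem h₁ h₂

/-- `acl` is the closure operator of the algebraic independence matroid of `K` over its prime field.
-/
theorem acl_eq_matroid_closure (X : Set K) :
    acl X = (AlgebraicIndependent.matroid (⊥ : Subfield K) K).closure X := by
  rw [AlgebraicIndependent.matroid_closure_eq]
  ext x
  rw [SetLike.mem_coe, Subalgebra.mem_algebraicClosure]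
  constructor
  · intro h
    rw [mem_acl_iff_isAlgebraic_subring] at h
    have hle : Subring.closure X ≤ (Algebra.adjoin (⊥ : Subfield K) X).toSubring :=
      Subring.closure_le.2 Algebra.subset_adjoin
    let : Algebra (Subring.closure X) (Algebra.adjoin (⊥ : Subfield K) X) :=
      (Subring.inclusion hle).toAlgebra
    have : IsScalarTower (Subring.closure X) (Algebra.adjoin (⊥ : Subfield K) X) K :=
      .of_algebraMap_eq fun _ ↦ rfl
    exact h.extendScalars (Subring.inclusion_injective hle)
  · exact mem_acl_of_isAlgebraic_adjoin bot_le subset_rfl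

theorem subset_acl (X : Set K) : X ⊆ acl X := by
  rw [acl_eq_matroid_closure]
  exact Matroid.subset_closure _ _

theorem acl_mono {X Y : Set K} (h : X ⊆ Y) : acl X ⊆ acl Y := by
  simp only [acl_eq_matroid_closure]
  exact Matroid.closure_subset_closure _ h

theorem acl_subset_acl {X Y : Set K} (h : X ⊆ acl Y) : acl X ⊆ acl Y := by
  simp only [acl_eq_matroid_closure] at h ⊢
  exact Matroid.closure_subset_closure_of_subset_closure h

theorem acl_exchange {X : Set K} {x y : K} (hx : x ∉ acl X) (h : x ∈ acl (insert y X)) :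
    y ∈ acl (insert x X) := by
  simp only [acl_eq_matroid_closure] at hx h ⊢
  exact Matroid.mem_closure_insert hx h

theorem exists_finite_of_mem_acl {X Y : Set K} {x : K} (h : x ∈ acl (X ∪ Y)) :
    ∃ Z ⊆ Y, Z.Finite ∧ x ∈ acl (X ∪ Z) := by
  rw [acl_eq_matroid_closure] at h
  obtain ⟨I, hI, hfin, -, hx⟩ := Matroid.exists_mem_finite_closure_of_mem_closure h
  refine ⟨I ∩ Y, Set.inter_subset_right, hfin.inter_of_left _, ?_⟩
  rw [← acl_eq_matroid_closure] at hx
  exact acl_mono (fun z hz ↦ (hI hz).imp id fun h ↦ ⟨hz, h⟩) hx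

theorem IsAclClosed.acl_subset {X Y : Set K} (hX : IsAclClosed X) (h : Y ⊆ X) : acl Y ⊆ X :=
  (acl_mono h).trans hX.subset

theorem add_mem_acl {X : Set K} {x y : K} (hx : x ∈ acl X) (hy : y ∈ acl X) : x + y ∈ acl X :=
  IsAlgebraic.add hx hy

theorem sub_mem_acl {X : Set K} {x y : K} (hx : x ∈ acl X) (hy : y ∈ acl X) : x - y ∈ acl X :=
  IsAlgebraic.sub hx hy

theorem isAclClosed_acl (X : Set K) : IsAclClosed (acl X) :=
  (acl_subset_acl subset_rfl).antisymm (subset_acl _)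

/-- In an algebraically closed field, the sets closed under `acl` are the algebraically closed
subfields. -/
theorem IsAclClosed.exists_subfield [IsAlgClosed K] {X : Set K} (hX : IsAclClosed X) :
    ∃ F : Subfield K, IsAlgClosed F ∧ (F : Set K) = X :=
  ⟨(algebraicClosure (Subfield.closure X) K).toSubfield,
    (algebraicClosure.isAlgClosure (Subfield.closure X) K).1, by
      refine Eq.trans ?_ hX
      ext x
      exact mem_algebraicClosure_iff⟩

/-- An element of `acl X` lies in every integrally closed subring that contains `X`, as long as
one particular nonzero denominator is invertible there. -/
theorem exists_denominator_of_mem_acl {X : Set K} {x : K} (hx : x ∈ acl X) :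
    ∃ f ∈ Subring.closure X, f ≠ 0 ∧ ∀ O : Subring K,
      (∀ y : K, IsIntegral O y → y ∈ O) → X ⊆ O → f⁻¹ ∈ O → x ∈ O := by
  rw [mem_acl_iff_isAlgebraic_subring] at hx
  obtain ⟨f, hf, hint⟩ := hx.exists_integral_multiple
  have hf' : (f : K) ≠ 0 := fun h ↦ hf (Subtype.ext h)
  refine ⟨f, f.2, hf', fun O hO hX hinv ↦ ?_⟩
  have hle : Subring.closure X ≤ O := Subring.closure_le.2 hX
  have h1 : (f : K) * x ∈ O := by
    refine hO _ ?_
    let : Algebra (Subring.closure X) O := (Subring.inclusion hle).toAlgebra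
    have : IsScalarTower (Subring.closure X) O K := .of_algebraMap_eq fun _ ↦ rfl
    exact IsIntegral.tower_top (R := Subring.closure X) hint
  simpa [hf'] using O.mul_mem hinv h1

end Acl

/-! ### Places and generic specialisations -/

section Place

variable {K : Type*} [Field K]

/-- The elements of `K` that are finite at the place `V` with residue in the residues of `B`:
the preimage of the image of `B` under the residue map of `V`. -/
def residueSubring (V : ValuationSubring K) (B : Subfield K) : Subring K where
  carrier := {x | ∃ b ∈ B, b ∈ V ∧ V.valuation (x - b) < 1}
  zero_mem' := ⟨0, B.zero_mem, V.zero_mem, by simp⟩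
  one_mem' := ⟨1, B.one_mem, V.one_mem, by simp⟩
  add_mem' := by
    rintro x y ⟨b, hb, hbV, hx⟩ ⟨c, hc, hcV, hy⟩
    refine ⟨b + c, add_mem hb hc, add_mem hbV hcV, ?_⟩
    rw [add_sub_add_comm]
    exact V.valuation.map_add_lt hx hy
  neg_mem' := by
    rintro x ⟨b, hb, hbV, hx⟩
    refine ⟨-b, neg_mem hb, neg_mem hbV, ?_⟩
    rwa [neg_sub_neg, V.valuation.map_sub_swap]
  mul_mem' := by
    rintro x y ⟨b, hb, hbV, hx⟩ ⟨c, hc, hcV, hy⟩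
    refine ⟨b * c, mul_mem hb hc, mul_mem hbV hcV, ?_⟩
    have hyV : V.valuation y ≤ 1 := by
      simpa using V.valuation.map_add_le hy.le ((V.valuation_le_one_iff c).2 hcV)
    rw [show x * y - b * c = (x - b) * y + b * (y - c) by ring]
    refine V.valuation.map_add_lt ?_ ?_ <;> rw [map_mul]
    · exact mul_lt_one_of_lt_of_le hx hyV
    · rw [mul_comm]
      exact mul_lt_one_of_lt_of_le hy ((V.valuation_le_one_iff b).2 hbV)

variable {V : ValuationSubring K} {B D : Subfield K}

theorem mem_residueSubring {x : K} :
    x ∈ residueSubring V B ↔ ∃ b ∈ B, b ∈ V ∧ V.valuation (x - b) < 1 :=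
  Iff.rfl

theorem residueSubring_mono {B' : Subfield K} (h : B ≤ B') :
    residueSubring V B ≤ residueSubring V B' := fun _ ⟨b, hb, hbV, hx⟩ ↦ ⟨b, h hb, hbV, hx⟩

theorem residueSubring_subset : (residueSubring V B : Set K) ⊆ V := by
  rintro x ⟨b, -, hbV, hx⟩
  have : x - b ∈ V := (V.valuation_le_one_iff _).1 hx.le
  simpa using add_mem this hbV

theorem subset_residueSubring (hB : (B : Set K) ⊆ V) : (B : Set K) ⊆ residueSubring V B :=
  fun b hb ↦ ⟨b, hb, hB hb, by simp⟩

/-- The residue map is injective on a subfield contained in the valuation ring. -/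
theorem eq_zero_of_valuation_lt_one (hD : (D : Set K) ⊆ V) {x : K} (hx : x ∈ D)
    (h : V.valuation x < 1) : x = 0 := by
  by_contra h0
  have hinv : V.valuation x⁻¹ ≤ 1 := (V.valuation_le_one_iff _).2 (hD (inv_mem hx))
  have := mul_lt_one_of_lt_of_le h hinv
  rw [← map_mul, mul_inv_cancel₀ h0, map_one] at this
  exact this.false

theorem inv_mem_residueSubring (hB : (B : Set K) ⊆ V) {f : K} (hf : f ∈ residueSubring V B)
    (hinv : f⁻¹ ∈ V) : f⁻¹ ∈ residueSubring V B := by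
  rcases eq_or_ne f 0 with rfl | hf0
  · simp
  obtain ⟨b, hb, hbV, h⟩ := hf
  have hinv' := (V.valuation_le_one_iff _).2 hinv
  have hb0 : b ≠ 0 := by
    rintro rfl
    have := mul_lt_one_of_lt_of_le h hinv'
    rw [← map_mul, sub_zero, mul_inv_cancel₀ hf0, map_one] at this
    exact this.false
  refine ⟨b⁻¹, inv_mem hb, hB (inv_mem hb), ?_⟩
  rw [show f⁻¹ - b⁻¹ = (f - b) * (-(f⁻¹ * b⁻¹)) by field_simp; ring, map_mul]
  refine mul_lt_one_of_lt_of_le h ((V.valuation_le_one_iff _).2 ?_)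
  exact neg_mem (mul_mem hinv (hB (inv_mem hb)))

/-- For an algebraically closed field `B ⊆ V`, `residueSubring V B` is integrally closed in `K`:
modulo the maximal ideal, a monic equation over it splits into linear factors over `B`. -/
theorem mem_residueSubring_of_isIntegral [IsAlgClosed B] (hB : (B : Set K) ⊆ V) {x : K}
    (hx : IsIntegral (residueSubring V B) x) : x ∈ residueSubring V B := by
  have hxV : V.valuation x ≤ 1 := by
    let : Algebra (residueSubring V B) V :=
      (Subring.inclusion (T := V.toSubring) residueSubring_subset :
        residueSubring V B →+* V.toSubring).toAlgebra
    have : IsScalarTower (residueSubring V B) V K := .of_algebraMap_eq fun _ ↦ rfl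
    obtain ⟨y, rfl⟩ := IsIntegrallyClosed.isIntegral_iff.1 (hx.tower_top (A := V))
    exact V.valuation_le_one y
  obtain ⟨P, hP, hPx⟩ := hx
  choose b hb hbV hbP using fun i ↦ mem_residueSubring.1 (P.coeff i).2
  -- `Q` is `P` with its coefficients replaced by representatives in `B` of their residues.
  let Q : Polynomial B := Polynomial.X ^ P.natDegree +
    ∑ i ∈ Finset.range P.natDegree, Polynomial.C (⟨b i, hb i⟩ : B) * Polynomial.X ^ i
  have hQ : Q.Monic := by
    refine Polynomial.monic_X_pow_add ?_
    rw [← Fin.sum_univ_eq_sum_range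
      (fun i ↦ Polynomial.C (⟨b i, hb i⟩ : B) * Polynomial.X ^ i)]
    exact Polynomial.degree_sum_fin_lt _
  have hQx : V.valuation (Polynomial.aeval x Q) < 1 := by
    have hdiff : Polynomial.aeval x Q =
        -∑ i ∈ Finset.range P.natDegree, ((P.coeff i : K) - b i) * x ^ i := by
      have h0 : x ^ P.natDegree +
          ∑ i ∈ Finset.range P.natDegree, (P.coeff i : K) * x ^ i = 0 := by
        rw [hP.as_sum] at hPx
        simp only [Polynomial.eval₂_add, Polynomial.eval₂_finsetSum, Polynomial.eval₂_mul,
          Polynomial.eval₂_C, Polynomial.eval₂_X_pow] at hPx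
        exact hPx
      simp only [Q, map_add, map_sum, map_mul, map_pow, Polynomial.aeval_X, Polynomial.aeval_C,
        sub_mul, Finset.sum_sub_distrib]
      change _ + ∑ i ∈ Finset.range P.natDegree, b i * x ^ i = _
      linear_combination h0
    rw [hdiff, Valuation.map_neg]
    refine V.valuation.map_sum_lt one_ne_zero fun i _ ↦ ?_
    rw [map_mul, map_pow]
    exact mul_lt_one_of_lt_of_le (hbP i) (pow_le_one₀ zero_le hxV)
  have hsplit : Q.Splits := IsAlgClosed.splits Q
  rw [hsplit.eq_prod_roots_of_monic hQ, map_multiset_prod, map_multiset_prod] at hQx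
  by_contra hnot
  refine hQx.not_ge (Multiset.one_le_prod_of_one_le ?_)
  simp only [Multiset.map_map, Multiset.mem_map]
  rintro _ ⟨r, -, rfl⟩
  refine le_of_not_gt fun hlt ↦ hnot ⟨r, r.2, hB r.2, ?_⟩
  change V.valuation (Polynomial.aeval x (Polynomial.X - Polynomial.C r)) < 1 at hlt
  rw [map_sub, Polynomial.aeval_X, Polynomial.aeval_C] at hlt
  exact hlt

/-- If `s` is algebraically independent over `D`, there is a place of `K` that is finite on `D` and
sends the elements of `s` to prescribed elements of `D`. -/
theorem exists_place {s : Set K} (hs : AlgebraicIndepOn D id s) (c : s → D) :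
    ∃ V : ValuationSubring K, (D : Set K) ⊆ V ∧ (∀ x : s, V.valuation (x - c x : K) < 1) ∧
      ∀ g : MvPolynomial s D, MvPolynomial.eval c g ≠ 0 →
        (MvPolynomial.aeval (fun x : s ↦ (x : K)) g)⁻¹ ∈ V := by
  -- A valuation ring dominating the local ring of `D[s]` at the point `c` is as required.
  let P : Ideal (MvPolynomial s D) := RingHom.ker (MvPolynomial.eval c)
  have : P.IsPrime := RingHom.ker_isPrime _
  let φ : MvPolynomial s D →+* K :=
    (MvPolynomial.aeval (fun x : s ↦ (x : K)) : MvPolynomial s D →ₐ[D] K)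
  have hφ : Function.Injective φ := hs
  have hunit : ∀ y : P.primeCompl, IsUnit (φ y) := by
    rintro ⟨y, hy⟩
    refine isUnit_iff_ne_zero.2 ((map_ne_zero_iff φ hφ).2 ?_)
    rintro rfl
    exact hy P.zero_mem
  let ψ : Localization.AtPrime P →+* K := IsLocalization.lift hunit
  have hψ : ∀ g, ψ (algebraMap _ _ g) = φ g := fun g ↦ IsLocalization.lift_eq hunit g
  obtain ⟨V, hV, hloc⟩ := IsLocalRing.exists_factor_valuationRing (R := Localization.AtPrime P) ψ
  refine ⟨V, fun d hd ↦ ?_, fun x ↦ ?_, fun g hg ↦ ?_⟩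
  · have := hV (algebraMap _ _ (MvPolynomial.C (⟨d, hd⟩ : D) : MvPolynomial s D))
    rw [hψ, show φ (MvPolynomial.C ⟨d, hd⟩) = d from MvPolynomial.aeval_C _ _] at this
    exact this
  · have hval : ψ (algebraMap _ _ (MvPolynomial.X x - MvPolynomial.C (c x))) = (x - c x : K) := by
      rw [hψ]
      simp [φ]
      rfl
    have hnot : ¬IsUnit (algebraMap _ (Localization.AtPrime P)
        (MvPolynomial.X x - MvPolynomial.C (c x))) := by
      rw [IsLocalization.AtPrime.isUnit_to_map_iff (Localization.AtPrime P) P]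
      simp [P, Ideal.primeCompl]
    rcases V.valuation_lt_one_or_eq_one
      ⟨_, hV (algebraMap _ _ (MvPolynomial.X x - MvPolynomial.C (c x)))⟩ with h | h
    · exact hval ▸ h
    · exact absurd (hloc.map_nonunit _ ((V.valuation_eq_one_iff _).2 h)) hnot
  · have hu : IsUnit (algebraMap _ (Localization.AtPrime P) g) :=
      (IsLocalization.AtPrime.isUnit_to_map_iff (Localization.AtPrime P) P g).2 hg
    obtain ⟨h, hh⟩ := hu.exists_right_inv
    have := congrArg ψ hh
    rw [map_mul, hψ, map_one] at this
    change (φ g)⁻¹ ∈ V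
    rw [inv_eq_of_mul_eq_one_right this]
    exact hV h

/-- `V` is a place of `K` finite on `D` that sends the elements of `s` to residues of `C`. -/
structure IsPlaceInto (C D : Subfield K) (s : Set K) (V : ValuationSubring K) : Prop where
  subset : (D : Set K) ⊆ V
  residue : s ⊆ residueSubring V C

theorem IsPlaceInto.adjoin_subset {C : Subfield K} {s : Set K} (hV : IsPlaceInto C D s V)
    {f : K} (hf : f ∈ Algebra.adjoin D s) : f ∈ V := by
  induction hf using Algebra.adjoin_induction with
  | mem y hy => exact residueSubring_subset (hV.residue hy)
  | algebraMap y => exact hV.subset y.2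
  | add _ _ _ _ h₁ h₂ => exact add_mem h₁ h₂
  | mul _ _ _ _ h₁ h₂ => exact mul_mem h₁ h₂

/-- The filter generated by the sets of places sending `s` into `C` at which a given nonzero
polynomial expression over `D` in the elements of `s` does not vanish. -/
def genericPlaces (C D : Subfield K) (s : Set K) : Filter (ValuationSubring K) where
  sets := {P | ∃ f ∈ Algebra.adjoin D s, f ≠ 0 ∧ ∀ V, IsPlaceInto C D s V → f⁻¹ ∈ V → V ∈ P}
  univ_sets := ⟨1, one_mem _, one_ne_zero, fun _ _ _ ↦ trivial⟩
  sets_of_superset := by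
    rintro P Q ⟨f, hf, hf0, h⟩ hPQ
    exact ⟨f, hf, hf0, fun V hV hfV ↦ hPQ (h V hV hfV)⟩
  inter_sets := by
    rintro P Q ⟨f, hf, hf0, hP⟩ ⟨g, hg, hg0, hQ⟩
    refine ⟨f * g, mul_mem hf hg, mul_ne_zero hf0 hg0, fun V hV hfg ↦ ⟨hP V hV ?_, hQ V hV ?_⟩⟩
    · convert mul_mem (hV.adjoin_subset hg) hfg using 1
      field_simp
    · convert mul_mem (hV.adjoin_subset hf) hfg using 1
      field_simp

theorem eventually_genericPlaces {C D : Subfield K} {s : Set K}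
    {p : ValuationSubring K → Prop} :
    (∀ᶠ V in genericPlaces C D s, p V) ↔
      ∃ f ∈ Algebra.adjoin D s, f ≠ 0 ∧ ∀ V, IsPlaceInto C D s V → f⁻¹ ∈ V → p V :=
  Iff.rfl

theorem eventually_isPlaceInto (C D : Subfield K) (s : Set K) :
    ∀ᶠ V in genericPlaces C D s, IsPlaceInto C D s V :=
  eventually_genericPlaces.2 ⟨1, one_mem _, one_ne_zero, fun _ hV _ ↦ hV⟩

/-- As `C` is infinite, a nonzero polynomial over `D` does not vanish on all tuples from `C`;
hence generic places exist. -/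
theorem genericPlaces_neBot {C : Subfield K} [Infinite C] (hCD : C ≤ D) {s : Set K}
    (hs : AlgebraicIndepOn D id s) : (genericPlaces C D s).NeBot := by
  refine ⟨fun hbot ↦ ?_⟩
  rw [← Filter.eventually_false_iff_eq_bot, eventually_genericPlaces] at hbot
  obtain ⟨f, hf, hf0, hV⟩ := hbot
  obtain ⟨g, rfl⟩ : ∃ g, MvPolynomial.aeval (fun x : s ↦ (x : K)) g = f := by
    rwa [← Subtype.range_coe (s := s), Algebra.adjoin_range_eq_range_aeval] at hf
  have hg : g ≠ 0 := by
    rintro rfl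
    exact hf0 (map_zero _)
  have hinf : (Set.range (Subfield.inclusion hCD)).Infinite :=
    Set.infinite_range_of_injective (Subfield.inclusion hCD).injective
  obtain ⟨c, hc, hgc⟩ : ∃ c : s → D, (∀ x, (c x : K) ∈ C) ∧ MvPolynomial.eval c g ≠ 0 := by
    by_contra! h
    refine hg (MvPolynomial.funext_set (fun _ ↦ Set.range (Subfield.inclusion hCD))
      (fun _ ↦ hinf) fun c hc ↦ ?_)
    rw [map_zero]
    refine h c fun x ↦ ?_
    obtain ⟨y, hy⟩ := hc x trivial
    exact hy ▸ y.2
  obtain ⟨V, hDV, hres, hinv⟩ := exists_place hs c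
  exact hV V ⟨hDV, fun x hx ↦ ⟨c ⟨x, hx⟩, hc _, hDV (c ⟨x, hx⟩).2, hres ⟨x, hx⟩⟩⟩ (hinv g hgc)

/-- Generically, an element algebraic over `B` and `s` is finite with residue in `B`. -/
theorem eventually_mem_residueSubring {C B D : Subfield K} [IsAlgClosed B] (hCB : C ≤ B)
    (hBD : B ≤ D) {s : Set K} {x : K} (hx : x ∈ acl (B ∪ s)) :
    ∀ᶠ V in genericPlaces C D s, x ∈ residueSubring V B := by
  obtain ⟨f, hf, hf0, h⟩ := exists_denominator_of_mem_acl hx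
  rw [eventually_genericPlaces]
  refine ⟨f, ?_, hf0, fun V hV hfV ↦ ?_⟩
  · have hle : Subring.closure (B ∪ s) ≤ (Algebra.adjoin D s).toSubring :=
      Subring.closure_le.2 (Set.union_subset
        (fun b hb ↦ (Algebra.adjoin D s).algebraMap_mem ⟨b, hBD hb⟩) Algebra.subset_adjoin)
    exact hle hf
  · have hBV : (B : Set K) ⊆ V := fun b hb ↦ hV.subset (hBD hb)
    have hBs : (B ∪ s : Set K) ⊆ residueSubring V B :=
      Set.union_subset (subset_residueSubring hBV)
        (hV.residue.trans (residueSubring_mono hCB))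
    exact h _ (fun y hy ↦ mem_residueSubring_of_isIntegral hBV hy) hBs
      (inv_mem_residueSubring hBV (Subring.closure_le.2 hBs hf) hfV)

end Place

/-! ### Specialising algebraic relations -/

section Specialise

variable {K : Type*} [Field K] {C B E D : Subfield K} {s : Set K}

/-- An element of `D` that is a difference of elements algebraic over `B ∪ s` and over `E ∪ s` is a
difference of elements of `B` and `E`: reduce the equation at a generic place. -/
theorem exists_sub_eq_of_mem_acl [Infinite C] [IsAlgClosed B] [IsAlgClosed E]
    (hCB : C ≤ B) (hCE : C ≤ E) (hBD : B ≤ D) (hED : E ≤ D) (hs : AlgebraicIndepOn D id s)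
    {u x : K} (hu : u ∈ acl (B ∪ s)) (hx : x ∈ acl (E ∪ s)) (hux : u - x ∈ D) :
    ∃ b ∈ B, ∃ e ∈ E, u - x = b - e := by
  have := genericPlaces_neBot (hCB.trans hBD) hs
  obtain ⟨V, hV, ⟨b, hb, -, hub⟩, ⟨e, he, -, hxe⟩⟩ := ((eventually_isPlaceInto C D s).and
    ((eventually_mem_residueSubring hCB hBD hu).and
      (eventually_mem_residueSubring hCE hED hx))).exists
  refine ⟨b, hb, e, he, sub_eq_zero.1 (eq_zero_of_valuation_lt_one hV.subset
    (sub_mem hux (sub_mem (hBD hb) (hED he))) ?_)⟩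
  rw [show u - x - (b - e) = (u - b) - (x - e) by ring]
  exact V.valuation.map_sub_lt hub hxe

/-- Let `w` be algebraic over both `B ∪ s` and `E ∪ s`. The elements of `B` that become algebraic
over a subfield `F ⊇ B ⊓ E` of `B` after adjoining `s` and `w` were already in `F`: a generic place
sends `w` to an element of `B ⊓ E`, hence the whole algebraic relation to one over `F`. -/
theorem mem_of_mem_acl_insert [Infinite C] [IsAlgClosed B] [IsAlgClosed E] [IsAlgClosed D]
    {F : Subfield K} [IsAlgClosed F]
    (hCB : C ≤ B) (hCE : C ≤ E) (hBD : B ≤ D) (hED : E ≤ D) (hs : AlgebraicIndepOn D id s)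
    (hBEF : B ⊓ E ≤ F) (hFB : F ≤ B) {w β : K} (hwB : w ∈ acl (B ∪ s)) (hwE : w ∈ acl (E ∪ s))
    (hβB : β ∈ B) (hβ : β ∈ acl (insert w (F ∪ s))) : β ∈ F := by
  have := genericPlaces_neBot (hCB.trans hBD) hs
  obtain ⟨f, hf, hf0, h⟩ := exists_denominator_of_mem_acl hβ
  -- `f` involves `w`, so it need not be a polynomial in `s`; being algebraic, `f⁻¹` is nevertheless
  -- finite at generic places.
  have hfinv : f⁻¹ ∈ acl (D ∪ s) := by
    have hfw : f ∈ Subfield.closure (acl (D ∪ s)) := by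
      refine Subfield.closure_mono ?_ (Subfield.subring_closure_le _ hf)
      refine Set.insert_subset ?_ ?_
      · exact acl_mono (Set.union_subset_union_left s hBD) hwB
      · exact (Set.union_subset_union_left s (hFB.trans hBD)).trans (subset_acl _)
    exact (isAclClosed_acl (D ∪ s)).subset
      (isAlgebraic_algebraMap (A := K) (⟨f⁻¹, inv_mem hfw⟩ : Subfield.closure (acl (D ∪ s))))
  obtain ⟨V, hV, ⟨b, hb, hbV, hwb⟩, ⟨e, he, -, hwe⟩, hfV⟩ :=
    ((eventually_isPlaceInto C D s).and ((eventually_mem_residueSubring hCB hBD hwB).and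
      ((eventually_mem_residueSubring hCE hED hwE).and
        (eventually_mem_residueSubring (hCB.trans hBD) le_rfl hfinv)))).exists
  -- The residue of `w` lies in `B ⊓ E`.
  have hbe : b = e := by
    refine sub_eq_zero.1 (eq_zero_of_valuation_lt_one hV.subset
      (sub_mem (hBD hb) (hED he)) ?_)
    rw [show b - e = (w - e) - (w - b) by ring]
    exact V.valuation.map_sub_lt hwe hwb
  have hFV : (F : Set K) ⊆ V := fun y hy ↦ hV.subset (hBD (hFB hy))
  have hsub : insert w (F ∪ s : Set K) ⊆ residueSubring V F := by
    have hCF : C ≤ F := (le_inf hCB hCE).trans hBEF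
    have hwF : w ∈ residueSubring V F := ⟨b, hBEF ⟨hb, hbe ▸ he⟩, hbV, hwb⟩
    exact Set.insert_subset hwF
      (Set.union_subset (subset_residueSubring hFV) (hV.residue.trans (residueSubring_mono hCF)))
  obtain ⟨γ, hγ, -, hβγ⟩ := h _ (fun y hy ↦ mem_residueSubring_of_isIntegral hFV hy) hsub
    (inv_mem_residueSubring hFV (Subring.closure_le.2 hsub hf) (residueSubring_subset hfV))
  have hβγ' : β = γ := sub_eq_zero.1 (eq_zero_of_valuation_lt_one hV.subset
    (sub_mem (hBD hβB) (hBD (hFB hγ))) hβγ)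
  exact hβγ' ▸ hγ

/-- Adjoining a set `s` independent over `D` commutes with intersections of algebraically closed
subfields `B` and `E` of `D`, even though these need not be independent over their intersection. The
proof removes the elements of `B` needed to define `w` one at a time. -/
theorem mem_acl_inter [IsAlgClosed K] [Infinite C] [IsAlgClosed D] [IsAlgClosed B] [IsAlgClosed E]
    (hB : IsAclClosed (B : Set K)) (hCB : C ≤ B) (hCE : C ≤ E) (hBD : B ≤ D) (hED : E ≤ D)
    (hs : AlgebraicIndepOn D id s) {w : K}
    (hwB : w ∈ acl (B ∪ s)) (hwE : w ∈ acl (E ∪ s)) : w ∈ acl (B ∩ E ∪ s) := by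
  have hwB' : w ∈ acl ((B ∩ E ∪ s) ∪ B) :=
    acl_mono (Set.union_subset Set.subset_union_right
      (Set.subset_union_right.trans Set.subset_union_left)) hwB
  obtain ⟨Y, hYB, hYfin, hwY⟩ := exists_finite_of_mem_acl hwB'
  induction Y, hYfin using Set.Finite.induction_on with
  | empty => simpa using hwY
  | @insert β Y _ _ ih =>
    have hYB' := (Set.insert_subset_iff.1 hYB).2
    by_contra hw
    have hwY' : w ∉ acl ((B ∩ E ∪ s) ∪ Y) := fun h ↦ hw (ih hYB' h)
    obtain ⟨F, hFalg, hF⟩ := (isAclClosed_acl (B ∩ E ∪ Y)).exists_subfield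
    have hβ : β ∈ F := by
      refine mem_of_mem_acl_insert hCB hCE hBD hED hs ?_ ?_ hwB hwE (hYB (Set.mem_insert _ _)) ?_
      · intro y hy
        rw [← SetLike.mem_coe, hF]
        exact subset_acl _ (Or.inl hy)
      · rw [← SetLike.coe_subset_coe, hF]
        exact hB.acl_subset (Set.union_subset Set.inter_subset_left hYB')
      · refine acl_mono (Set.insert_subset_insert ?_)
          (acl_exchange hwY' (by rwa [← Set.union_insert]))
        have := subset_acl ((B : Set K) ∩ E ∪ Y)
        rw [hF]
        grind
    rw [← SetLike.mem_coe, hF] at hβ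
    refine hwY' (acl_subset_acl ?_ hwY)
    rw [Set.union_insert]
    exact Set.insert_subset (acl_mono (by grind) hβ) (subset_acl _)

end Specialise

/-! ### Algebraic independence -/

section Independence

variable {K : Type*} [Field K]

theorem AlgebraicIndepOn.of_subfield_le {F F' : Subfield K} (h : F ≤ F') {s : Set K}
    (hs : AlgebraicIndepOn F' id s) : AlgebraicIndepOn F id s := by
  let : Algebra F F' := (Subfield.inclusion h).toAlgebra
  have : IsScalarTower F F' K := .of_algebraMap_eq fun _ ↦ rfl
  exact AlgebraicIndependent.restrictScalars (R := F) (K := F')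
    (Subfield.inclusion h).injective hs

/-- A set has a transcendence basis over a subfield. -/
theorem exists_algebraicIndepOn_subset_acl (F : Subfield K) (A : Set K) :
    ∃ s ⊆ A, AlgebraicIndepOn F id s ∧ A ⊆ acl (F ∪ s) := by
  obtain ⟨s, hs⟩ := (AlgebraicIndependent.matroid F K).exists_isBasis A
  refine ⟨s, hs.subset, AlgebraicIndependent.matroid_indep_iff.1 hs.indep, fun x hx ↦ ?_⟩
  have hx' := hs.subset_closure hx
  rw [AlgebraicIndependent.matroid_closure_eq, SetLike.mem_coe,
    Subalgebra.mem_algebraicClosure] at hx'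
  exact mem_acl_of_isAlgebraic_adjoin (fun y hy ↦ Subfield.subset_closure (Or.inl hy))
    Set.subset_union_right hx'

end Independence

end ACFG

/-! ### Mixed transitivity -/

open ACFG

theorem mainTheorem7 (p : ℕ) [Fact p.Prime] {K : Type*} [Field K] [IsAlgClosed K] [CharP K p]
    (G : AddSubgroup K) (A B C D : Set K)
    (hA : ACFG.IsAclClosed A) (hB : ACFG.IsAclClosed B)
    (hC : ACFG.IsAclClosed C) (hD : ACFG.IsAclClosed D)
    (hCA : C ⊆ A) (hCB : C ⊆ B) (hBD : B ⊆ D)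
    (hAB : ACFG.Monotonised (ACFG.WeakIndep G) A C B)
    (hAD : ACFG.StrongIndep G A B D) :
    ACFG.Monotonised (ACFG.WeakIndep G) A C D := by
  obtain ⟨B, hBalg, rfl⟩ := hB.exists_subfield
  obtain ⟨C, hCalg, rfl⟩ := hC.exists_subfield
  obtain ⟨D, hDalg, rfl⟩ := hD.exists_subfield
  intro X hX
  have hXD : X ⊆ D := hX.trans (Set.union_subset (hCB.trans hBD) subset_rfl)
  have hCXD : (C ∪ X : Set K) ⊆ D := Set.union_subset (hCB.trans hBD) hXD
  -- `A` is algebraically independent from `D` over `C`, by transitivity.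
  have hindep : ∀ s ⊆ A, AlgebraicIndepOn C id s → AlgebraicIndepOn D id s := by
    intro s hsA hs
    have h₁ := (hAB ∅ (Set.empty_subset _)).1 s hsA
    have h₂ := hAD.1 s hsA
    rw [Set.union_empty, Set.union_eq_left.2 hCB, Set.union_eq_left.2 hCB,
      Subfield.closure_eq, Subfield.closure_eq] at h₁
    rw [Set.union_eq_left.2 hBD, Subfield.closure_eq, Subfield.closure_eq] at h₂
    exact h₂ (h₁ hs)
  have hDCX : (D ∪ C ∪ (C ∪ X) : Set K) = D := by grind
  refine ⟨fun s hsA hs ↦ ?_, ?_⟩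
  · rw [hDCX, Subfield.closure_eq]
    refine hindep s hsA (AlgebraicIndepOn.of_subfield_le ?_ hs)
    exact fun c hc ↦ Subfield.subset_closure (Or.inl hc)
  rw [hDCX, hD]
  refine Set.Subset.antisymm ?_ ?_
  swap
  · rintro _ ⟨x, ⟨hxG, hx⟩, d, ⟨hdG, hd⟩, rfl⟩
    exact ⟨add_mem hxG hdG, Set.add_mem_add hx hd⟩
  rintro _ ⟨hgG, x, hx, d, hd, rfl⟩
  obtain ⟨E, hEalg, hE⟩ := (isAclClosed_acl (C ∪ X)).exists_subfield
  have hCXE : (C ∪ X : Set K) ⊆ E := hE ▸ subset_acl _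
  have hCE : C ≤ E := fun c hc ↦ hCXE (Or.inl hc)
  have hED : E ≤ D := by
    rw [← SetLike.coe_subset_coe, hE]
    exact hD.acl_subset hCXD
  obtain ⟨s, hsA, hsC, hAs⟩ := exists_algebraicIndepOn_subset_acl C A
  have hs := hindep s hsA hsC
  have hA_le : ∀ F : Subfield K, C ≤ F → (A ∪ F : Set K) ⊆ acl (F ∪ s) := fun F hCF ↦
    Set.union_subset (hAs.trans (acl_mono (Set.union_subset_union_left s hCF)))
      (Set.subset_union_left.trans (subset_acl _))
  -- Strong independence moves the problem from `x + d` to an element `u` of `G ∩ acl (A ∪ B)`.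
  have hg : x + d ∈ (G : Set K) ∩ acl (A ∪ D ∪ B) := by
    have hxADB : x ∈ acl (A ∪ D ∪ B) := acl_mono (Set.union_subset_union_right A hCXD |>.trans
      Set.subset_union_left) hx
    exact ⟨hgG, add_mem_acl hxADB (subset_acl _ (Or.inl (Or.inr hd)))⟩
  rw [hAD.2, Set.union_eq_left.2 hBD, hD] at hg
  obtain ⟨u, ⟨huG, hu⟩, v, ⟨hvG, hv⟩, huv⟩ := hg
  have hu' : u ∈ acl (B ∪ s) := acl_subset_acl (hA_le B hCB) hu
  have hx' : x ∈ acl (E ∪ s) :=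
    acl_subset_acl (hA_le E hCE) (acl_mono (Set.union_subset_union_right A hCXE) hx)
  have hux : u - x = d - v := by linear_combination huv
  obtain ⟨b, hb, e, he, hbe⟩ := exists_sub_eq_of_mem_acl (C := C) hCB hCE hBD hED hs hu' hx'
    (hux ▸ sub_mem hd hv)
  -- `w = u - b = x - e` is algebraic over `B ∪ s` and over `E ∪ s`.
  have hwB : u - b ∈ acl (B ∪ s) := sub_mem_acl hu' (subset_acl _ (Or.inl hb))
  have hwE : u - b ∈ acl (E ∪ s) := by
    rw [show u - b = x - e by linear_combination hbe]
    exact sub_mem_acl hx' (subset_acl _ (Or.inl he))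
  have hw := mem_acl_inter hB hCB hCE hBD hED hs hwB hwE
  have hBE : (B ∩ E : Set K) ⊆ C ∪ B := fun y hy ↦ Or.inr hy.1
  -- The hypothesis on `A` and `B`, over the base `C ∪ (B ∩ E)`, now splits `u` within `G`.
  have hu'' : u ∈ (G : Set K) ∩ (acl (A ∪ (C ∪ B ∩ E)) + acl (B ∪ C ∪ (C ∪ B ∩ E))) := by
    refine ⟨huG, u - b, acl_mono ?_ hw, b, subset_acl _ (Or.inl (Or.inl hb)), by simp⟩
    grind
  rw [(hAB (B ∩ E) hBE).2] at hu''
  obtain ⟨u₁, ⟨hu₁G, hu₁⟩, b₁, ⟨hb₁G, hb₁⟩, rfl⟩ := hu''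
  have hb₁B : b₁ ∈ D := hBD (hB.acl_subset (by grind) hb₁)
  refine ⟨u₁, ⟨hu₁G, acl_subset_acl ?_ hu₁⟩, b₁ + v,
    ⟨add_mem hb₁G hvG, add_mem hb₁B hv⟩, ?_⟩
  · refine Set.union_subset (Set.subset_union_left.trans (subset_acl _)) ?_
    refine Set.union_subset ?_ ?_
    · exact fun c hc ↦ subset_acl _ (Or.inr (Or.inl hc))
    · rintro y ⟨-, hy⟩
      rw [hE] at hy
      exact acl_mono Set.subset_union_right hy
  · exact (add_assoc u₁ b₁ v).symm.trans huv
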